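/- Let $p$ be a prime and let $G$ be a group of order $p^5$ whose nilpotence class is at least $3$. For a complex irreducible character $\chi$ of $G$, let $\ker\chi=\{g\in G : \chi(g)=\chi(1)\}$ and let the codegree of $\chi$ be $\operatorname{cod}(\chi)=|G:\ker\chi|/\chi(1)$; let $\operatorname{cod}(G)=\{\operatorname{cod}(\chi) : \chi\in\operatorname{Irr}(G)\}$ be the set of codegrees of the complex irreducible characters of $G$. Then $p^2\in\operatorname{cod}(G)$. -/

import Mathlib

noncomputable section

/-- `Irr(G)`: the set of complex irreducible characters of `G`, as functions `G → ℂ`. -/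
def Irr (G : Type*) [Group G] : Set (G → ℂ) :=
  {χ | ∃ (V : Type) (_ : AddCommGroup V) (_ : Module ℂ V) (_ : FiniteDimensional ℂ V)
      (ρ : Representation ℂ G V), ρ.IsIrreducible ∧ ρ.character = χ}

/-- The kernel `{g | χ g = χ 1}` of a character `χ`, as a subgroup. It is written as the subgroup
generated by this set so that it makes sense for every function `χ`; for a character of a finite
group the set is already a subgroup, namely the kernel of any representation affording `χ`
(see `characterKer_eq_ker` and `coe_characterKer`). -/
def characterKer {G : Type*} [Group G] (χ : G → ℂ) : Subgroup G :=
  Subgroup.closure {g | χ g = χ 1}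

/-- The codegree `|G : ker χ| / χ(1)`. -/
def codegree {G : Type*} [Group G] (χ : G → ℂ) : ℂ :=
  ((characterKer χ).index : ℂ) / χ 1

/-- `cod(G)`: the set of codegrees of the irreducible characters of `G`. -/
def cod (G : Type*) [Group G] : Set ℂ :=
  codegree '' Irr G

theorem character_eq_iff_apply_eq_one {G : Type*} [Group G] [Finite G] {V : Type*} [AddCommGroup V]
    [Module ℂ V] [FiniteDimensional ℂ V] (ρ : Representation ℂ G V) (g : G) :
    ρ.character g = ρ.character 1 ↔ ρ g = 1 := by
  refine ⟨fun h => ?_, fun h => by simp [Representation.character, h]⟩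
  have hm : 0 < orderOf g := orderOf_pos g
  have hT : (ρ g) ^ orderOf g = 1 := by rw [← map_pow, pow_orderOf_eq_one, map_one]
  have hroot : ∀ z ∈ (ρ g).charpoly.roots, ‖z‖ = 1 := by
    intro z hz
    have hz' : Module.End.HasEigenvalue (ρ g) z := by
      rw [Module.End.hasEigenvalue_iff_isRoot_charpoly]
      exact Polynomial.isRoot_of_mem_roots hz
    obtain ⟨v, hv⟩ := hz'.exists_hasEigenvector
    have h1 := hv.pow_apply (orderOf g)
    rw [hT, Module.End.one_apply] at h1
    have h2 : z ^ orderOf g = 1 := by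
      have h3 : (1 - z ^ orderOf g) • v = 0 := by rw [sub_smul, one_smul, ← h1, sub_self]
      rcases smul_eq_zero.1 h3 with h4 | h4
      · exact (sub_eq_zero.1 h4).symm
      · exact absurd h4 hv.2
    exact Complex.norm_eq_one_of_pow_eq_one h2 hm.ne'
  have hsplit : (ρ g).charpoly.Splits := IsAlgClosed.splits _
  have hcard : (ρ g).charpoly.roots.card = Module.finrank ℂ V := by
    rw [← (ρ g).charpoly_natDegree, hsplit.natDegree_eq_card_roots]
  have htr : (ρ g).charpoly.roots.sum = (Module.finrank ℂ V : ℂ) := by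
    rw [← Module.End.trace_eq_sum_roots_charpoly_of_splits hsplit]
    simpa [Representation.character] using h
  have hone : ∀ z ∈ (ρ g).charpoly.roots, z = 1 := by
    have hre : ((ρ g).charpoly.roots.map (fun z => 1 - z.re)).sum = 0 := by
      have h5 : ((ρ g).charpoly.roots.map Complex.re).sum = (Module.finrank ℂ V : ℝ) := by
        have := congrArg Complex.re htr
        rw [Complex.natCast_re] at this
        rw [← this]
        exact (map_multiset_sum Complex.reAddGroupHom _).symm
      rw [Multiset.sum_map_sub, h5]
      simp [hcard]
    intro z hz
    have hnn : ∀ x ∈ (ρ g).charpoly.roots.map (fun z => 1 - z.re), 0 ≤ x := by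
      intro x hx
      obtain ⟨w, hw, rfl⟩ := Multiset.mem_map.1 hx
      have := Complex.re_le_norm w
      rw [hroot w hw] at this
      linarith
    have h6 : 1 - z.re = 0 :=
      Multiset.all_zero_of_le_zero_le_of_sum_eq_zero hnn hre _
        (Multiset.mem_map_of_mem _ hz)
    have h7 : z.re = 1 := by linarith
    have h8 := Complex.sq_norm z
    rw [hroot z hz, Complex.normSq_apply, h7] at h8
    have h9 : z.im = 0 := by nlinarith
    exact Complex.ext (by simpa using h7) (by simpa using h9)
  have hpoly : (ρ g).charpoly = (Polynomial.X - Polynomial.C 1) ^ Module.finrank ℂ V := by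
    rw [hsplit.eq_prod_roots_of_monic (LinearMap.charpoly_monic _),
      Multiset.eq_replicate.2 ⟨hcard, hone⟩]
    simp
  have hnil : IsNilpotent (ρ g - 1) := by
    refine ⟨Module.finrank ℂ V, ?_⟩
    have := LinearMap.aeval_self_charpoly (ρ g)
    rw [hpoly] at this
    simpa using this
  have hss : Module.End.IsSemisimple (ρ g) := by
    refine Module.End.isSemisimple_of_squarefree_aeval_eq_zero
      (p := Polynomial.X ^ orderOf g - 1) ?_ (by simp [hT])
    refine (Polynomial.separable_X_pow_sub_C (1 : ℂ) ?_ one_ne_zero).squarefree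
    exact_mod_cast hm.ne'
  have hss' : Module.End.IsSemisimple (ρ g - 1) := by
    have := Module.End.isSemisimple_sub_algebraMap_iff (f := ρ g) (μ := (1 : ℂ))
    simpa using this.2 hss
  exact sub_eq_zero.1 (Module.End.eq_zero_of_isNilpotent_isSemisimple hnil hss')

theorem characterKer_eq_ker {G : Type*} [Group G] [Finite G] {V : Type*} [AddCommGroup V]
    [Module ℂ V] [FiniteDimensional ℂ V] (ρ : Representation ℂ G V) :
    characterKer ρ.character = MonoidHom.ker ρ := by
  have : {g | ρ.character g = ρ.character 1} = (MonoidHom.ker ρ : Set G) := by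
    ext g
    exact character_eq_iff_apply_eq_one ρ g
  rw [characterKer, this, Subgroup.closure_eq]

theorem coe_characterKer {G : Type*} [Group G] [Finite G] {χ : G → ℂ} (hχ : χ ∈ Irr G) :
    (characterKer χ : Set G) = {g | χ g = χ 1} := by
  obtain ⟨V, _, _, _, ρ, -, rfl⟩ := hχ
  rw [characterKer_eq_ker]
  ext g
  exact (character_eq_iff_apply_eq_one ρ g).symm

end

/-!
A nonabelian group of order `p ^ 3` has a faithful irreducible representation: every nontrivial
normal subgroup contains the derived subgroup, so it suffices that some derived element acts
nontrivially. Its degree is at most `p`, the index of an abelian subgroup, and is divisible by `p`,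
since a derived central element of order `p` acts as a scalar of determinant `1`. So its degree is
`p` and its codegree is `p ^ 2`. Codegrees of quotients are codegrees of the group, hence it is
enough to find in `G` a normal subgroup `N` of order `p ^ 2` with `G ⧸ N` nonabelian.

If `|Z(G)| ≥ p ^ 2`, take `N` inside `Z(G)`, which does not contain `G'` because the class is at
least `3`. If `|Z(G)| = p`, put `Q = G ⧸ Z(G)`, of order `p ^ 4`. The exponent of `Z(Q)` divides
that of `Z(G)`, so each nontrivial element of `Z(Q)` generates a subgroup of order `p`. If all
subgroups of order `p` of `Z(Q)` contained `Q'`, then `|Q'| = p`, so `|Z(Q)| ≥ p ^ 2` by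
`|Q : Z(Q)| ≤ |Q'| ^ 2`, and an element of `Z(Q)` outside `Q'` would generate one that does not.
-/

open Module Representation Subgroup
open scoped MonoidAlgebra

universe u

section CentralSeries

variable {G : Type*} [Group G]

theorem normal_of_le_center {N : Subgroup G} (h : N ≤ center G) : N.Normal where
  conj_mem n hn g := by rwa [mem_center_iff.1 (h hn) g, mul_inv_cancel_right]

theorem commutator_le_iff_le_comap {H : Type*} [Group H] {f : G →* H} (hf : Function.Surjective f)
    {S : Subgroup H} : commutator H ≤ S ↔ commutator G ≤ S.comap f := by
  rw [commutator_def, commutator_def, ← map_le_iff_le_comap, map_commutator,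
    map_top_of_surjective f hf]

theorem commutator_quotient_eq_bot_iff {N : Subgroup G} [N.Normal] :
    commutator (G ⧸ N) = ⊥ ↔ commutator G ≤ N := by
  rw [← le_bot_iff, commutator_le_iff_le_comap (QuotientGroup.mk'_surjective N),
    MonoidHom.comap_bot, QuotientGroup.ker_mk']

theorem index_centralizer_le_card_commutator [Finite G] (x : G) :
    (centralizer {x}).index ≤ Nat.card (commutator G) := by
  have hle : commutatorSet G ⊆ commutator G := commutator_eq_closure G ▸ subset_closure
  exact (Nat.card_le_card_of_injective _ (quotientCentralizerEmbedding x).injective).trans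
    (Nat.card_mono (Set.toFinite _) hle)

theorem exponent_center_quotient_center_dvd :
    Monoid.exponent (center (G ⧸ center G)) ∣ Monoid.exponent (center G) := by
  refine Monoid.exponent_dvd_of_forall_pow_eq_one ?_
  rintro ⟨q, hq⟩
  obtain ⟨z, rfl⟩ := QuotientGroup.mk_surjective q
  refine Subtype.ext ((QuotientGroup.eq_one_iff _).2 (mem_center_iff.2 fun g => ?_))
  have hw : z⁻¹ * (g * z * g⁻¹) ∈ center G := by
    rw [← QuotientGroup.eq, QuotientGroup.mk_mul, QuotientGroup.mk_mul, QuotientGroup.mk_inv,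
      mem_center_iff.1 hq, mul_inv_cancel_right]
  have hcomm : Commute z (z⁻¹ * (g * z * g⁻¹)) := mem_center_iff.1 hw z
  have hpow : (z⁻¹ * (g * z * g⁻¹)) ^ Monoid.exponent (center G) = 1 :=
    congrArg Subtype.val (Monoid.pow_exponent_eq_one (⟨_, hw⟩ : center G))
  rw [← mul_inv_eq_iff_eq_mul, ← conj_pow]
  calc (g * z * g⁻¹) ^ Monoid.exponent (center G)
      = (z * (z⁻¹ * (g * z * g⁻¹))) ^ Monoid.exponent (center G) := by rw [mul_inv_cancel_left]
    _ = z ^ Monoid.exponent (center G) := by rw [hcomm.mul_pow, hpow, mul_one]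

theorem not_commutator_le_center_of_three_le_nilpotencyClass
    (h : 3 ≤ Group.nilpotencyClass G) : ¬ commutator G ≤ center G := fun hle => by
  have hbot : (⊤ : Subgroup G).lowerCentralSeries 2 = ⊥ := by
    rw [Subgroup.lowerCentralSeries_succ, top_lowerCentralSeries_one]
    exact commutator_top_right_eq_bot_iff_le_center.2 hle
  have : Group.IsNilpotent G := Subgroup.nilpotent_iff_lowerCentralSeries.2 ⟨2, hbot⟩
  exact absurd (Subgroup.lowerCentralSeries_eq_bot_iff_nilpotencyClass_le.1 hbot) (by lia)

end CentralSeries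

section PGroups

variable {p : ℕ} [hp : Fact p.Prime] {G : Type*} [Group G]

theorem index_eq_prime_pow_of_card_eq_prime_pow {m n : ℕ} {N : Subgroup G}
    (hG : Nat.card G = p ^ (m + n)) (hN : Nat.card N = p ^ n) : N.index = p ^ m := by
  refine Nat.eq_of_mul_eq_mul_right (pow_pos hp.out.pos n) ?_
  rw [← hN, index_mul_card, hG, hN, pow_add]

theorem isMulCommutative_of_card_dvd_prime_sq (hG : Nat.card G ∣ p ^ 2) : IsMulCommutative G := by
  obtain ⟨n, hn, hcard⟩ := (Nat.dvd_prime_pow hp.out).1 hG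
  obtain hn1 | rfl := Nat.lt_or_eq_of_le hn
  · have := isCyclic_of_card_dvd_prime (hcard ▸ pow_dvd_pow p (Nat.le_of_lt_succ hn1) |>.trans
      (pow_one p).dvd)
    infer_instance
  · exact IsPGroup.isMulCommutative_of_card_eq_prime_sq hcard

theorem prime_dvd_relIndex_of_not_le [Finite G] (hG : IsPGroup p G) {H K : Subgroup G}
    (h : ¬ K ≤ H) : p ∣ H.relIndex K := by
  obtain ⟨n, hn⟩ := (hG.to_subgroup K).index (H.subgroupOf K)
  have hn0 : n ≠ 0 := by
    rintro rfl
    exact h (relIndex_eq_one.1 (hn.trans (pow_zero p)))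
  exact (dvd_pow_self p hn0).trans hn.symm.dvd

theorem prime_dvd_card_of_ne_bot [Finite G] (hG : IsPGroup p G) {H : Subgroup G} (h : H ≠ ⊥) :
    p ∣ Nat.card H :=
  relIndex_bot_left H ▸ prime_dvd_relIndex_of_not_le hG (mt le_bot_iff.1 h)

theorem commutator_le_of_card_eq_prime_cube (hG : Nat.card G = p ^ 3) {N : Subgroup G} [N.Normal]
    (hN : N ≠ ⊥) : commutator G ≤ N := by
  have : Finite G := Nat.finite_of_card_ne_zero (hG ▸ pow_ne_zero 3 hp.out.ne_zero)
  obtain ⟨m, hm⟩ := prime_dvd_card_of_ne_bot (.of_card hG) hN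
  have hindex : N.index ∣ p ^ 2 := by
    refine ⟨m, Nat.eq_of_mul_eq_mul_left hp.out.pos ?_⟩
    rw [← pow_succ', ← hG, ← N.card_mul_index, hm]
    ring
  have := isMulCommutative_of_card_dvd_prime_sq (N.index_eq_card ▸ hindex)
  exact Normal.quotient_commutative_iff_commutator_le.1 this

theorem sq_mul_index_center_centralizer_dvd [Finite G] (hG : IsPGroup p G) {d : G}
    (hd : d ∉ center G) :
    p ^ 2 * (center (centralizer {d})).index ∣ (center G).index := by
  let K := centralizer {d}
  have hdK : d ∈ K := mem_centralizer_singleton_iff.2 rfl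
  have hK : p ∣ K.index := by
    refine relIndex_top_right K ▸ prime_dvd_relIndex_of_not_le hG fun h => hd ?_
    exact mem_center_iff.2 fun g => mem_centralizer_singleton_iff.1 (h (mem_top g))
  have hZ : (center G).subgroupOf K ≤ center K := fun z hz =>
    mem_center_iff.2 fun k => Subtype.ext (mem_center_iff.1 hz k)
  have hZK : p ∣ ((center G).subgroupOf K).relIndex (center K) := by
    refine prime_dvd_relIndex_of_not_le (hG.to_subgroup K) fun h => hd ?_
    have hdZ : (⟨d, hdK⟩ : K) ∈ center K := mem_center_iff.2 fun k =>
      Subtype.ext (mem_centralizer_singleton_iff.1 k.2)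
    exact h hdZ
  have hindex : (center G).index =
      ((center G).subgroupOf K).relIndex (center K) * (center K).index * K.index := by
    rw [relIndex_mul_index hZ, ← relIndex, relIndex_mul_index (center_le_centralizer _)]
  rw [hindex, sq, mul_right_comm]
  exact mul_dvd_mul (mul_dvd_mul_right hZK _) hK

theorem isMulCommutative_centralizer_of_index_center_dvd_prime_cube [Finite G]
    (hG : IsPGroup p G) (hindex : (center G).index ∣ p ^ 3) {d : G} (hd : d ∉ center G) :
    IsMulCommutative (centralizer {d}) := by
  have hdvd : (center (centralizer {d})).index ∣ p :=
    Nat.dvd_of_mul_dvd_mul_left (pow_pos hp.out.pos 2)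
      ((sq_mul_index_center_centralizer_dvd hG hd).trans hindex)
  have := isCyclic_of_card_dvd_prime (index_eq_card (center (centralizer {d})) ▸ hdvd)
  exact isMulCommutative_of_isCyclic_quotient_center_self _

theorem index_center_le_card_commutator_sq [Finite G] (hG : IsPGroup p G)
    (hindex : (center G).index ∣ p ^ 3) :
    (center G).index ≤ Nat.card (commutator G) ^ 2 := by
  by_cases hcomm : ∀ x y : G, y * x = x * y
  · have htop : center G = ⊤ := eq_top_iff.2 fun x _ => mem_center_iff.2 (hcomm x)
    rw [htop, index_top]
    exact Nat.one_le_pow _ _ Nat.card_pos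
  push Not at hcomm
  obtain ⟨x, y, hxy⟩ := hcomm
  -- Centralizers of noncentral elements are abelian, so none contains both `x` and `y`.
  have hle : centralizer {x} ⊓ centralizer {y} ≤ center G := by
    rintro d ⟨hdx, hdy⟩
    by_contra hd
    have := isMulCommutative_centralizer_of_index_center_dvd_prime_cube hG hindex hd
    have hx : x ∈ centralizer {d} :=
      mem_centralizer_singleton_iff.2 (mem_centralizer_singleton_iff.1 hdx).symm
    have hy : y ∈ centralizer {d} :=
      mem_centralizer_singleton_iff.2 (mem_centralizer_singleton_iff.1 hdy).symm
    exact hxy (congrArg Subtype.val (mul_comm' (⟨y, hy⟩ : centralizer {d}) ⟨x, hx⟩))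
  calc (center G).index ≤ (centralizer {x} ⊓ centralizer {y}).index := index_antitone hle
    _ ≤ (centralizer {x}).index * (centralizer {y}).index := index_inf_le
    _ ≤ Nat.card (commutator G) ^ 2 := sq (Nat.card (commutator G)) ▸
        Nat.mul_le_mul (index_centralizer_le_card_commutator x)
          (index_centralizer_le_card_commutator y)

theorem prime_dvd_card_center_of_card_eq_prime_pow {n : ℕ} (hG : Nat.card G = p ^ n)
    (hn : 0 < n) : p ∣ Nat.card (center G) := by
  obtain ⟨k, hk, hZ⟩ := IsPGroup.card_center_eq_prime_pow hG hn
  exact hZ ▸ dvd_pow_self p hk.ne'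

theorem prime_sq_le_card_center_of_card_commutator_le (hG : Nat.card G = p ^ 4)
    (hcomm : Nat.card (commutator G) ≤ p) : p ^ 2 ≤ Nat.card (center G) := by
  have : Finite G := Nat.finite_of_card_ne_zero (hG ▸ pow_ne_zero 4 hp.out.ne_zero)
  have hindex : (center G).index ∣ p ^ 3 := by
    refine Nat.dvd_of_mul_dvd_mul_left hp.out.pos ?_
    rw [← pow_succ', ← hG, ← (center G).card_mul_index]
    exact mul_dvd_mul_right (prime_dvd_card_center_of_card_eq_prime_pow hG four_pos) _
  have hle : (center G).index ≤ p ^ 2 :=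
    (index_center_le_card_commutator_sq (.of_card hG) hindex).trans (Nat.pow_le_pow_left hcomm 2)
  refine Nat.le_of_mul_le_mul_right ?_ (pow_pos hp.out.pos 2)
  calc p ^ 2 * p ^ 2 = Nat.card (center G) * (center G).index := by
        rw [card_mul_index, hG, ← pow_add]
    _ ≤ Nat.card (center G) * p ^ 2 := Nat.mul_le_mul_left _ hle

theorem exists_le_center_card_eq_prime_not_commutator_le (hG : Nat.card G = p ^ 4)
    (hexp : Monoid.exponent (center G) ∣ p) (hcomm : commutator G ≠ ⊥) :
    ∃ S ≤ center G, Nat.card S = p ∧ ¬ commutator G ≤ S := by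
  have : Finite G := Nat.finite_of_card_ne_zero (hG ▸ pow_ne_zero 4 hp.out.ne_zero)
  by_contra! hle
  have hpZ := prime_dvd_card_center_of_card_eq_prime_pow hG four_pos
  obtain ⟨S, hSZ, hS⟩ := Sylow.exists_subgroup_le_card_pow_prime_of_le_card hp.out (.of_card hG)
    ((pow_one p).trans_le (Nat.le_of_dvd Nat.card_pos hpZ))
  rw [pow_one] at hS
  have hderiv : Nat.card (commutator G) ≤ p := hS ▸ card_le_of_le (hle S hSZ hS)
  have hlt : Nat.card (commutator G) < Nat.card (center G) := hderiv.trans_lt <|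
    (lt_self_pow₀ hp.out.one_lt one_lt_two).trans_le <|
      prime_sq_le_card_center_of_card_commutator_le hG hderiv
  obtain ⟨q, hqZ, hq⟩ : ∃ q ∈ center G, q ∉ commutator G :=
    SetLike.not_le_iff_exists.1 fun h => hlt.not_ge (card_le_of_le h)
  have hqp : Nat.card (zpowers q) = p := by
    refine (Nat.card_zpowers q).trans (orderOf_eq_prime ?_ fun h => hq (h ▸ one_mem _))
    exact congrArg Subtype.val (Monoid.exponent_dvd_iff_forall_pow_eq_one.1 hexp ⟨q, hqZ⟩)
  have hle_q : commutator G ≤ zpowers q := hle _ (zpowers_le.2 hqZ) hqp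
  obtain h1 | h1 := (Nat.dvd_prime hp.out).1 (hqp ▸ card_dvd_of_le hle_q)
  · exact hcomm (eq_bot_of_card_eq _ h1)
  · exact hq (eq_of_le_of_card_ge hle_q (hqp.trans h1.symm).le ▸ mem_zpowers q)

theorem exists_normal_card_eq_prime_sq_not_commutator_le (hG : Nat.card G = p ^ 5)
    (hcomm : ¬ commutator G ≤ center G) :
    ∃ N : Subgroup G, N.Normal ∧ Nat.card N = p ^ 2 ∧ ¬ commutator G ≤ N := by
  have : Finite G := Nat.finite_of_card_ne_zero (hG ▸ pow_ne_zero 5 hp.out.ne_zero)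
  obtain ⟨k, hk, hZ⟩ := IsPGroup.card_center_eq_prime_pow hG (by norm_num)
  obtain hk2 | rfl : 2 ≤ k ∨ k = 1 := by lia
  · obtain ⟨N, hNZ, hN⟩ := Sylow.exists_subgroup_le_card_pow_prime_of_le_card hp.out (.of_card hG)
      (hZ ▸ Nat.pow_le_pow_right hp.out.pos hk2 : p ^ 2 ≤ Nat.card (center G))
    exact ⟨N, normal_of_le_center hNZ, hN, fun h => hcomm (h.trans hNZ)⟩
  have hQ : Nat.card (G ⧸ center G) = p ^ 4 := index_eq_prime_pow_of_card_eq_prime_pow hG hZ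
  have hexp : Monoid.exponent (center (G ⧸ center G)) ∣ p :=
    exponent_center_quotient_center_dvd.trans
      (Group.exponent_dvd_nat_card.trans (hZ.trans (pow_one p)).dvd)
  obtain ⟨S, hSZ, hS, hSQ⟩ := exists_le_center_card_eq_prime_not_commutator_le hQ hexp
    (mt commutator_quotient_eq_bot_iff.1 hcomm)
  have := normal_of_le_center hSZ
  refine ⟨S.comap (QuotientGroup.mk' (center G)), inferInstance, ?_,
    mt (commutator_le_iff_le_comap (QuotientGroup.mk'_surjective _)).2 hSQ⟩
  calc Nat.card (S.comap (QuotientGroup.mk' (center G)))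
      = Nat.card (center G) * Nat.card S := QuotientGroup.card_preimage_mk (center G) S
    _ = p ^ 2 := by rw [hZ, hS, pow_one, sq]

end PGroups

section Subrepresentations

variable {G k V : Type*} [Monoid G] [Field k] [AddCommGroup V] [Module k V]
  {ρ : Representation k G V}

theorem nontrivial_of_isIrreducible (ρ : Representation k G V) [ρ.IsIrreducible] : Nontrivial V :=
  IsSimpleModule.nontrivial k[G] ρ.asModule

theorem span_range_apply_eq_top [hρ : ρ.IsIrreducible] {v : V} (hv : v ≠ 0) :
    Submodule.span k (Set.range (ρ · v)) = ⊤ := by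
  let W : Subrepresentation ρ :=
    { toSubmodule := Submodule.span k (Set.range (ρ · v))
      apply_mem_toSubmodule := fun g w hw => by
        refine Submodule.span_induction ?_ ?_ ?_ ?_ hw
        · rintro _ ⟨h, rfl⟩
          exact Submodule.subset_span ⟨g * h, by simp⟩
        · simp
        · intro x y _ _ hx hy
          simpa using add_mem hx hy
        · intro a x _ hx
          simpa using Submodule.smul_mem _ a hx }
  have hvW : v ∈ W.toSubmodule := Submodule.subset_span ⟨1, by simp⟩
  have hW : W ≠ ⊥ := by
    intro hbot
    rw [hbot] at hvW
    exact hv hvW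
  exact congrArg Subrepresentation.toSubmodule ((hρ.eq_bot_or_eq_top W).resolve_left hW)

theorem isIrreducible_comp_of_surjective {H : Type*} [Monoid H] [ρ.IsIrreducible] {f : H →* G}
    (hf : Function.Surjective f) : IsIrreducible (ρ.comp f : Representation k H V) := by
  let e : Subrepresentation (ρ.comp f : Representation k H V) ≃o Subrepresentation ρ :=
    { toFun σ := ⟨σ.toSubmodule, hf.forall.2 σ.apply_mem_toSubmodule⟩
      invFun σ := ⟨σ.toSubmodule, fun h => σ.apply_mem_toSubmodule (f h)⟩
      left_inv _ := rfl
      right_inv _ := rfl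
      map_rel_iff' := Iff.rfl }
  exact e.isSimpleOrder

theorem isIrreducible_toRepresentation_of_isAtom {σ : Subrepresentation ρ} (hσ : IsAtom σ) :
    σ.toRepresentation.IsIrreducible where
  exists_pair_ne := by
    refine ⟨⊥, ⊤, fun h => hσ.1 (Subrepresentation.toSubmodule_injective ?_)⟩
    have hbot : (⊥ : Submodule k σ.toSubmodule) = ⊤ := congrArg Subrepresentation.toSubmodule h
    exact (Submodule.map_subtype_top σ.toSubmodule).symm.trans (hbot ▸ Submodule.map_bot _)
  eq_bot_or_eq_top τ := by
    let τ' : Subrepresentation ρ :=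
      { toSubmodule := τ.toSubmodule.map σ.toSubmodule.subtype
        apply_mem_toSubmodule := by
          rintro g _ ⟨w, hw, rfl⟩
          exact ⟨_, τ.apply_mem_toSubmodule g hw, rfl⟩ }
    have hle : τ' ≤ σ := Submodule.map_subtype_le σ.toSubmodule τ.toSubmodule
    have hinj : Function.Injective fun τ : Subrepresentation σ.toRepresentation =>
        τ.toSubmodule.map σ.toSubmodule.subtype :=
      (Submodule.map_injective_of_injective σ.toSubmodule.subtype_injective).comp
        Subrepresentation.toSubmodule_injective
    refine (hσ.le_iff.1 hle).imp (fun h => hinj ?_) fun h => hinj ?_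
    · exact (congrArg Subrepresentation.toSubmodule h).trans (Submodule.map_bot _).symm
    · exact (congrArg Subrepresentation.toSubmodule h).trans (Submodule.map_subtype_top _).symm

theorem exists_isAtom_subrepresentation [FiniteDimensional k V] [Nontrivial V]
    (ρ : Representation k G V) : ∃ σ : Subrepresentation ρ, IsAtom σ := by
  have : WellFoundedLT (Subrepresentation ρ) :=
    StrictMono.wellFoundedLT (f := Subrepresentation.toSubmodule) fun _ _ h => h
  have htop : (⊤ : Subrepresentation ρ) ≠ ⊥ := fun h =>
    top_ne_bot (α := Submodule k V) (congrArg Subrepresentation.toSubmodule h)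
  obtain ⟨σ, hσ, -⟩ := (eq_bot_or_exists_atom_le (⊤ : Subrepresentation ρ)).resolve_left htop
  exact ⟨σ, hσ⟩

theorem exists_isAtom_subrepresentation_apply_ne [ρ.IsSemisimpleRepresentation] {c : G}
    (hc : ρ c ≠ 1) : ∃ σ : Subrepresentation ρ, IsAtom σ ∧ ∃ v ∈ σ, ρ c v ≠ v := by
  by_contra! hfix
  have := (isSemisimpleRepresentation_iff_isSemisimpleModule_asModule ρ).1 inferInstance
  refine hc (LinearMap.ext fun v => ?_)
  have hv : ρ.asModuleEquiv.symm v ∈ ⨆ m : {m : Submodule k[G] ρ.asModule // IsAtom m}, m.1 :=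
    ((sSup_eq_iSup' _).symm.trans (sSup_atoms_eq_top (α := Submodule k[G] ρ.asModule))).ge
      Submodule.mem_top
  refine Submodule.iSup_induction _ (motive := fun w => ρ c (ρ.asModuleEquiv w) = ρ.asModuleEquiv w)
    hv ?_ ?_ ?_
  · rintro ⟨m, hm⟩ w hw
    exact hfix (Subrepresentation.subrepresentationSubmoduleOrderIso.symm m)
      ((OrderIso.isAtom_iff _ m).2 hm) _ hw
  · simp only [map_zero]
  · intro x y hx hy
    simp only [map_add, hx, hy]

theorem exists_ne_zero_forall_apply_mem_span_singleton [IsMulCommutative G] [IsAlgClosed k]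
    [FiniteDimensional k V] [Nontrivial V] (ρ : Representation k G V) :
    ∃ v ≠ 0, ∀ g, ρ g v ∈ Submodule.span k {v} := by
  obtain ⟨σ, hσ⟩ := exists_isAtom_subrepresentation ρ
  have := isIrreducible_toRepresentation_of_isAtom hσ
  have hdim := IsIrreducible.finrank_eq_one_of_isMulCommutative σ.toRepresentation
  obtain ⟨v, hv, hspan⟩ := finrank_eq_one_iff'.1 hdim
  refine ⟨v, by simpa using hv, fun g => ?_⟩
  obtain ⟨μ, hμ⟩ := hspan (σ.toRepresentation g v)
  exact Submodule.mem_span_singleton.2 ⟨μ, congrArg Subtype.val hμ⟩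

end Subrepresentations

theorem det_apply_eq_one_of_mem_commutator {G R M : Type*} [Group G] [CommRing R]
    [AddCommGroup M] [Module R M] (ρ : Representation R G M) {c : G} (hc : c ∈ commutator G) :
    LinearMap.det (ρ c) = 1 :=
  congrArg Units.val
    (Abelianization.commutator_subset_ker (MonoidHom.toHomUnits (LinearMap.det.comp ρ)) hc)

section Irreducible

variable {G k V : Type*} [Group G] [Field k] [AddCommGroup V] [Module k V]
  {ρ : Representation k G V}

theorem exists_eq_smul_one_of_mem_center [IsAlgClosed k] [FiniteDimensional k V]
    [ρ.IsIrreducible] {c : G} (hc : c ∈ center G) : ∃ μ : k, ρ c = μ • 1 := by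
  obtain ⟨μ, hμ⟩ := IsIrreducible.algebraMap_intertwiningMap_bijective_of_isAlgClosed.2
    (IntertwiningMap.centralMul ρ c hc)
  exact ⟨μ, congrArg IntertwiningMap.toLinearMap hμ.symm⟩

theorem orderOf_dvd_finrank_of_injective [IsAlgClosed k] [FiniteDimensional k V] [ρ.IsIrreducible]
    (hρ : Function.Injective ρ) {c : G} (hcenter : c ∈ center G)
    (hcomm : c ∈ commutator G) : orderOf c ∣ finrank k V := by
  obtain ⟨μ, hμ⟩ := exists_eq_smul_one_of_mem_center (ρ := ρ) hcenter
  -- `ρ c` is a scalar `μ` by Schur's lemma, and has determinant `1` as a product of commutators.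
  have hdet : μ ^ finrank k V = 1 := by
    rw [← det_apply_eq_one_of_mem_commutator ρ hcomm, hμ, LinearMap.det_smul, map_one, mul_one]
  refine orderOf_dvd_of_pow_eq_one (hρ ?_)
  rw [map_pow, hμ, smul_pow, one_pow, hdet, one_smul, map_one]

theorem finrank_le_index_of_forall_apply_mem_span_singleton [ρ.IsIrreducible] {A : Subgroup G}
    [A.FiniteIndex] {v : V} (hv : v ≠ 0) (hA : ∀ a ∈ A, ρ a v ∈ Submodule.span k {v}) :
    finrank k V ≤ A.index := by
  have := Fintype.ofFinite (G ⧸ A)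
  let b : G ⧸ A → V := fun q => ρ q.out v
  have hspan : Submodule.span k (Set.range b) = ⊤ := by
    rw [eq_top_iff, ← span_range_apply_eq_top (ρ := ρ) hv, Submodule.span_le]
    rintro _ ⟨g, rfl⟩
    obtain ⟨a, ha⟩ := QuotientGroup.mk_out_eq_mul A g
    obtain ⟨μ, hμ⟩ := Submodule.mem_span_singleton.1 (hA _ (inv_mem a.2))
    have hg : ρ g v = μ • b g := by
      rw [← map_smul, hμ, ← Module.End.mul_apply, ← map_mul, ha, mul_inv_cancel_right]
    exact Set.mem_of_eq_of_mem hg <| Submodule.smul_mem _ μ (Submodule.subset_span ⟨g, rfl⟩)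
  have hcard := finrank_range_le_card (R := k) b
  rwa [Set.finrank, hspan, finrank_top, ← Nat.card_eq_fintype_card, ← index_eq_card]
    at hcard

theorem finrank_le_index_of_isMulCommutative [IsAlgClosed k] [FiniteDimensional k V]
    [ρ.IsIrreducible] (A : Subgroup G) [IsMulCommutative A] [A.FiniteIndex] :
    finrank k V ≤ A.index := by
  have := nontrivial_of_isIrreducible ρ
  obtain ⟨v, hv, hspan⟩ := exists_ne_zero_forall_apply_mem_span_singleton
    (ρ.comp A.subtype : Representation k A V)
  exact finrank_le_index_of_forall_apply_mem_span_singleton hv fun a ha => hspan ⟨a, ha⟩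

theorem finrank_eq_prime_of_card_eq_prime_cube {p : ℕ} [hp : Fact p.Prime] [IsAlgClosed k]
    [FiniteDimensional k V] [ρ.IsIrreducible] (hG : Nat.card G = p ^ 3) (hcomm : commutator G ≠ ⊥)
    (hρ : Function.Injective ρ) : finrank k V = p := by
  have : Finite G := Nat.finite_of_card_ne_zero (hG ▸ pow_ne_zero 3 hp.out.ne_zero)
  have hpG : IsPGroup p G := .of_card hG
  have := nontrivial_of_isIrreducible ρ
  obtain ⟨c, hc, hc1⟩ := (commutator G).bot_or_exists_ne_one.resolve_left hcomm
  have : Nontrivial G := ⟨c, 1, hc1⟩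
  have hcenter : c ∈ center G := commutator_le_of_card_eq_prime_cube hG hpG.bot_lt_center.ne' hc
  have hdvd : p ∣ finrank k V :=
    (hpG.dvd_orderOf hc1).trans (orderOf_dvd_finrank_of_injective hρ hcenter hc)
  obtain ⟨A, hA⟩ := Sylow.exists_subgroup_card_pow_prime p (hG ▸ pow_dvd_pow p (Nat.le_succ 2))
  have := IsPGroup.isMulCommutative_of_card_eq_prime_sq hA
  have hindex : A.index = p ^ 1 := index_eq_prime_pow_of_card_eq_prime_pow hG hA
  have hle : finrank k V ≤ p :=
    pow_one p ▸ hindex ▸ finrank_le_index_of_isMulCommutative (ρ := ρ) A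
  exact hle.antisymm (Nat.le_of_dvd finrank_pos hdvd)

end Irreducible

theorem leftRegular_injective (k G : Type*) [Monoid G] [Semiring k] [Nontrivial k] :
    Function.Injective (leftRegular k G) := fun g h hgh =>
  MonoidAlgebra.of_injective (R := k) <| by
    simpa using LinearMap.congr_fun hgh (MonoidAlgebra.single 1 1)

theorem exists_isIrreducible_apply_ne_one {G : Type*} (k : Type u) [Group G] [Finite G] [Field k]
    [NeZero (Nat.card G : k)] {c : G} (hc : c ≠ 1) :
    ∃ (V : Type u) (_ : AddCommGroup V) (_ : Module k V) (_ : FiniteDimensional k V)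
      (σ : Representation k G V), σ.IsIrreducible ∧ σ c ≠ 1 := by
  -- `G` is moved to the universe of `k`, so that the regular representation lies there too.
  let e : G ≃* Shrink.{u} G := Shrink.mulEquiv.symm
  let ρ : Representation k G k[Shrink.{u} G] := (leftRegular k (Shrink.{u} G)).comp e.toMonoidHom
  have hρ : Function.Injective ρ := (leftRegular_injective k _).comp e.injective
  have hρc : ρ c ≠ 1 := fun h => hc (hρ (h.trans (map_one ρ).symm))
  obtain ⟨σ, hσ, v, hv, hcv⟩ := exists_isAtom_subrepresentation_apply_ne hρc
  exact ⟨σ.toSubmodule, inferInstance, inferInstance, inferInstance, σ.toRepresentation,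
    isIrreducible_toRepresentation_of_isAtom hσ,
    fun h => hcv (congrArg Subtype.val (LinearMap.congr_fun h ⟨v, hv⟩))⟩

section Codegrees

theorem index_ker_div_finrank_mem_cod {G : Type*} [Group G] [Finite G] {V : Type} [AddCommGroup V]
    [Module ℂ V] [FiniteDimensional ℂ V] (ρ : Representation ℂ G V) [hρ : ρ.IsIrreducible] :
    ((MonoidHom.ker ρ).index : ℂ) / finrank ℂ V ∈ cod G := by
  refine ⟨ρ.character, ⟨V, _, _, inferInstance, ρ, hρ, rfl⟩, ?_⟩
  rw [codegree, characterKer_eq_ker, char_one]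

theorem cod_subset_of_surjective {G H : Type*} [Group G] [Group H] [Finite G] {f : G →* H}
    (hf : Function.Surjective f) : cod H ⊆ cod G := by
  have := Finite.of_surjective f hf
  rintro _ ⟨_, ⟨V, _, _, _, ρ, hρ, rfl⟩, rfl⟩
  have := isIrreducible_comp_of_surjective (ρ := ρ) hf
  have hmem := index_ker_div_finrank_mem_cod (ρ.comp f : Representation ℂ G V)
  have hindex : (MonoidHom.ker (ρ.comp f)).index = (MonoidHom.ker ρ).index :=
    Subgroup.index_comap_of_surjective (MonoidHom.ker ρ) hf
  rwa [hindex, ← char_one ρ, ← characterKer_eq_ker] at hmem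

theorem prime_sq_mem_cod_of_card_eq_prime_cube {p : ℕ} [hp : Fact p.Prime] {G : Type*} [Group G]
    (hG : Nat.card G = p ^ 3) (hcomm : commutator G ≠ ⊥) : (p : ℂ) ^ 2 ∈ cod G := by
  have : Finite G := Nat.finite_of_card_ne_zero (hG ▸ pow_ne_zero 3 hp.out.ne_zero)
  obtain ⟨c, hc, hc1⟩ := (commutator G).bot_or_exists_ne_one.resolve_left hcomm
  obtain ⟨V, _, _, _, ρ, _, hρc⟩ := exists_isIrreducible_apply_ne_one ℂ hc1
  have hker : MonoidHom.ker ρ = ⊥ := by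
    by_contra hbot
    exact hρc (commutator_le_of_card_eq_prime_cube hG hbot hc)
  have hdim : finrank ℂ V = p :=
    finrank_eq_prime_of_card_eq_prime_cube hG hcomm ((MonoidHom.ker_eq_bot_iff _).1 hker)
  have hp0 : (p : ℂ) ≠ 0 := Nat.cast_ne_zero.2 hp.out.ne_zero
  have hmem := index_ker_div_finrank_mem_cod ρ
  rwa [hker, index_bot, hG, hdim, Nat.cast_pow, pow_succ, mul_div_cancel_right₀ _ hp0] at hmem

end Codegrees

theorem mainTheorem5 (p : ℕ) (hp : p.Prime) (G : Type*) [Group G] (hG : Nat.card G = p ^ 5)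
    (hclass : 3 ≤ Group.nilpotencyClass G) : (p : ℂ) ^ 2 ∈ cod G := by
  have : Fact p.Prime := ⟨hp⟩
  have : Finite G := Nat.finite_of_card_ne_zero (hG ▸ pow_ne_zero 5 hp.ne_zero)
  obtain ⟨N, _, hN, hcomm⟩ := exists_normal_card_eq_prime_sq_not_commutator_le hG
    (not_commutator_le_center_of_three_le_nilpotencyClass hclass)
  have hQ : Nat.card (G ⧸ N) = p ^ 3 := index_eq_prime_pow_of_card_eq_prime_pow hG hN
  exact cod_subset_of_surjective (QuotientGroup.mk'_surjective N)
    (prime_sq_mem_cod_of_card_eq_prime_cube hQ (mt commutator_quotient_eq_bot_iff.1 hcomm))
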